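/- Let $G$ be a finitely generated group that is residually torsion-free nilpotent: there are normal subgroups $G=N_0\supseteq N_1\supseteq\cdots$ with every $G/N_k$ torsion-free nilpotent and $\bigcap_k N_k=\{1\}$. Let $\gamma_1(G)=G$, $\gamma_{n+1}(G)=[\gamma_n(G),G]$ be the lower central series, and let $$G_n=\{x\in G\mid x^k\in\gamma_n(G)\text{ for some }k\ge 1\}\qquad(n\ge1)$$ be the isolators of its terms; these are normal subgroups with $\bigcap_n G_n=\{1\}$. Choose arbitrarily a total bi-invariant group order on each quotient $G_n/G_{n+1}$, and order $G$ by declaring $x\neq 1$ positive if and only if, for the unique $n$ with $x\in G_n\setminus G_{n+1}$, the class $xG_{n+1}$ is greater than $1$ in $G_n/G_{n+1}$ (and $x<y$ if and only if $x^{-1}y$ is positive); this is a bi-invariant total order on $G$. Let $\mathbb{Q}\langle G\rangle$ be the Mal'cev--Neumann ring of all formal series $\sum_{g\in G}a_g g$ with $a_g\in\mathbb{Q}$ whose support is well-ordered, with the convolution product. For $n\ge1$ let $\mathbb{Q}[G_n]\langle G/G_n\rangle$ be the set of all formal series of the form $\sum_{t\in T}\lambda_t t$, where $T$ is a well-ordered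 subset of some transversal of $G_n$ in $G$ and $\lambda_t\in\mathbb{Q}[G_n]$ for every $t\in T$. Then $$S(G)=\bigcup_{n\ge 1}\mathbb{Q}[G_n]\langle G/G_n\rangle$$ is a subring of $\mathbb{Q}\langle G\rangle$ and is a division ring: $S(G)\ne 0$, and every nonzero element of $S(G)$ has a two-sided inverse lying in $S(G)$. -/

import Mathlib

open Set

/-! ### Isolators of the lower central series -/

section Isolators

open scoped commutatorElement

variable {G : Type*} [Group G]

theorem commutator_pow_eq_one {x g : G} {k : ℕ} (hc : Commute ⁅x, g⁆ x)
    (hk : Commute (x ^ k) g) : ⁅x, g⁆ ^ k = 1 := by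
  have h1 : g * x * g⁻¹ = ⁅x, g⁆⁻¹ * x := by
    rw [commutatorElement_def]; group
  have h2 : g * x ^ k * g⁻¹ = (⁅x, g⁆⁻¹) ^ k * x ^ k := by
    rw [← conj_pow, h1, (hc.inv_left).mul_pow]
  rw [← hk.eq, mul_inv_cancel_right] at h2
  have h3 : (⁅x, g⁆⁻¹) ^ k = 1 := by
    have := h2.symm
    rwa [mul_eq_right] at this
  rwa [inv_pow, inv_eq_one] at h3

theorem commute_mk_of_mem_lowerCentralSeries {n : ℕ} {x : G}
    (hx : x ∈ (⊤ : Subgroup G).lowerCentralSeries n) (g : G) :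
    Commute (x : G ⧸ (⊤ : Subgroup G).lowerCentralSeries (n + 1)) (g : G ⧸ _) := by
  rw [← commutatorElement_eq_one_iff_commute]
  have h : ⁅x, g⁆ ∈ (⊤ : Subgroup G).lowerCentralSeries (n + 1) :=
    Subgroup.commutator_mem_commutator hx (Subgroup.mem_top g)
  have h2 := (QuotientGroup.eq_one_iff (N := (⊤ : Subgroup G).lowerCentralSeries (n + 1)) _).2 h
  exact h2

theorem isOfFinOrder_mk_of_mem_lowerCentralSeries {S : Set G} (hS : Subgroup.closure S = ⊤)
    (hfin : ∀ s ∈ S, IsOfFinOrder s) (n : ℕ) : ∀ x ∈ (⊤ : Subgroup G).lowerCentralSeries n,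
    IsOfFinOrder (x : G ⧸ (⊤ : Subgroup G).lowerCentralSeries (n + 1)) := by
  induction n with
  | zero =>
    intro x hx
    have hx' : x ∈ Subgroup.closure S := hS ▸ Subgroup.mem_top x
    induction hx' using Subgroup.closure_induction with
    | mem s hs => exact (QuotientGroup.mk' _).isOfFinOrder (hfin s hs)
    | one => exact IsOfFinOrder.one
    | mul a b _ _ ha hb =>
      exact Commute.isOfFinOrder_mul (commute_mk_of_mem_lowerCentralSeries (Subgroup.mem_top _) _)
        (ha (Subgroup.mem_top _)) (hb (Subgroup.mem_top _))
    | inv a _ ha => exact (ha (Subgroup.mem_top _)).inv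
  | succ n ih =>
    intro x hx
    have hx' : x ∈ Subgroup.closure
        {x | ∃ p ∈ (⊤ : Subgroup G).lowerCentralSeries n, ∃ q ∈ (⊤ : Subgroup G), ⁅p, q⁆ = x} := hx
    have key : x ∈ (⊤ : Subgroup G).lowerCentralSeries (n + 1) ∧
        IsOfFinOrder (x : G ⧸ (⊤ : Subgroup G).lowerCentralSeries (n + 1 + 1)) := by
      clear hx
      induction hx' using Subgroup.closure_induction with
      | mem s hs =>
        obtain ⟨p, hp, q, hq, rfl⟩ := hs
        have hmem : ⁅p, q⁆ ∈ (⊤ : Subgroup G).lowerCentralSeries (n + 1) :=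
          Subgroup.commutator_mem_commutator hp hq
        refine ⟨hmem, ?_⟩
        obtain ⟨k, hk0, hk⟩ := isOfFinOrder_iff_pow_eq_one.1 (ih p hp)
        rw [← QuotientGroup.mk_pow, QuotientGroup.eq_one_iff] at hk
        refine isOfFinOrder_iff_pow_eq_one.2 ⟨k, hk0, ?_⟩
        exact commutator_pow_eq_one
          (x := (p : G ⧸ (⊤ : Subgroup G).lowerCentralSeries (n + 1 + 1))) (g := (q : G ⧸ _))
          (commute_mk_of_mem_lowerCentralSeries hmem p)
          (commute_mk_of_mem_lowerCentralSeries hk q)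
      | one => exact ⟨Subgroup.one_mem _, IsOfFinOrder.one⟩
      | mul a b _ _ ha hb =>
        exact ⟨Subgroup.mul_mem _ ha.1 hb.1,
          Commute.isOfFinOrder_mul (commute_mk_of_mem_lowerCentralSeries ha.1 _) ha.2 hb.2⟩
      | inv a _ ha => exact ⟨Subgroup.inv_mem _ ha.1, ha.2.inv⟩
    exact key.2

theorem isOfFinOrder_of_closure_eq_top [Group.IsNilpotent G] {S : Set G}
    (hS : Subgroup.closure S = ⊤) (hfin : ∀ s ∈ S, IsOfFinOrder s) (x : G) : IsOfFinOrder x := by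
  have h : ∀ n : ℕ, ∃ k : ℕ, 0 < k ∧ x ^ k ∈ (⊤ : Subgroup G).lowerCentralSeries n := by
    intro n
    induction n with
    | zero => exact ⟨1, one_pos, Subgroup.mem_top _⟩
    | succ n ih =>
      obtain ⟨k, hk, hx⟩ := ih
      obtain ⟨l, hl, hxl⟩ := isOfFinOrder_iff_pow_eq_one.1
        (isOfFinOrder_mk_of_mem_lowerCentralSeries hS hfin n _ hx)
      refine ⟨k * l, Nat.mul_pos hk hl, ?_⟩
      rwa [← QuotientGroup.mk_pow, QuotientGroup.eq_one_iff, ← pow_mul] at hxl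
  obtain ⟨n, hn⟩ := Subgroup.nilpotent_iff_lowerCentralSeries.1 ‹Group.IsNilpotent G›
  obtain ⟨k, hk, hx⟩ := h n
  rw [hn, Subgroup.mem_bot] at hx
  exact isOfFinOrder_iff_pow_eq_one.2 ⟨k, hk, hx⟩

theorem isOfFinOrder_mul_of_isNilpotent [Group.IsNilpotent G] {a b : G} (ha : IsOfFinOrder a)
    (hb : IsOfFinOrder b) : IsOfFinOrder (a * b) := by
  have hau : a ∈ Subgroup.closure {a, b} := Subgroup.subset_closure (by simp)
  have hbu : b ∈ Subgroup.closure {a, b} := Subgroup.subset_closure (by simp)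
  have h := isOfFinOrder_of_closure_eq_top (G := Subgroup.closure {a, b})
    (S := ((↑) : Subgroup.closure {a, b} → G) ⁻¹' {a, b})
    Subgroup.closure_closure_coe_preimage
    (by
      rintro ⟨s, hs⟩ hs'
      rw [← (Subgroup.subtype_injective _).isOfFinOrder_iff]
      rcases hs' with h | h
      · change s = a at h
        subst h; exact ha
      · change s = b at h
        subst h; exact hb)
    (⟨a, hau⟩ * ⟨b, hbu⟩)
  rw [← (Subgroup.subtype_injective _).isOfFinOrder_iff] at h
  exact h

instance isNilpotent_quotient_lowerCentralSeries (n : ℕ) :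
    Group.IsNilpotent (G ⧸ (⊤ : Subgroup G).lowerCentralSeries n) := by
  rw [Subgroup.nilpotent_iff_lowerCentralSeries]
  refine ⟨n, ?_⟩
  rw [← Subgroup.map_top_of_surjective (QuotientGroup.mk' ((⊤ : Subgroup G).lowerCentralSeries n))
    (QuotientGroup.mk'_surjective _), ← Subgroup.map_lowerCentralSeries,
    QuotientGroup.map_mk'_self]

variable (G) in
/-- The isolator `{x | ∃ k > 0, x ^ k ∈ γ}` of a term `γ` of the lower central series of `G`.
Terms are numbered from `0`, so that `isolator G 0 = G` and `isolator G 1` is the isolator of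
`[G, G]`. -/
def isolator (n : ℕ) : Subgroup G where
  carrier := {x | ∃ k : ℕ, 0 < k ∧ x ^ k ∈ (⊤ : Subgroup G).lowerCentralSeries n}
  one_mem' := ⟨1, one_pos, by simp⟩
  inv_mem' := by
    rintro x ⟨k, hk, h⟩
    exact ⟨k, hk, by rw [inv_pow]; exact Subgroup.inv_mem _ h⟩
  mul_mem' := by
    have key : ∀ x : G, (∃ k : ℕ, 0 < k ∧ x ^ k ∈ (⊤ : Subgroup G).lowerCentralSeries n) ↔
        IsOfFinOrder (x : G ⧸ (⊤ : Subgroup G).lowerCentralSeries n) := by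
      intro x
      rw [isOfFinOrder_iff_pow_eq_one]
      simp only [← QuotientGroup.mk_pow, QuotientGroup.eq_one_iff]
    intro x y hx hy
    exact (key _).2 (isOfFinOrder_mul_of_isNilpotent ((key x).1 hx) ((key y).1 hy))

theorem mem_isolator {n : ℕ} {x : G} :
    x ∈ isolator G n ↔ ∃ k : ℕ, 0 < k ∧ x ^ k ∈ (⊤ : Subgroup G).lowerCentralSeries n := Iff.rfl

instance isolator_normal (n : ℕ) : (isolator G n).Normal where
  conj_mem := by
    rintro x ⟨k, hk, h⟩ g
    exact ⟨k, hk, by rw [conj_pow]; exact Subgroup.Normal.conj_mem inferInstance _ h g⟩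

theorem isolator_zero : isolator G 0 = ⊤ :=
  eq_top_iff.2 fun _ _ => ⟨1, one_pos, Subgroup.mem_top _⟩

theorem isolator_antitone : Antitone (isolator G) := by
  rintro m n hmn x ⟨k, hk, h⟩
  exact ⟨k, hk, Subgroup.lowerCentralSeries_antitone _ hmn h⟩

theorem mem_isolator_of_pow_mem {n : ℕ} {x : G} {k : ℕ} (hk : 0 < k)
    (h : x ^ k ∈ isolator G n) : x ∈ isolator G n := by
  obtain ⟨l, hl, h⟩ := h
  exact ⟨k * l, Nat.mul_pos hk hl, by rwa [pow_mul]⟩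

theorem mem_upperCentralSeries_of_pow_mem (htf : ∀ x : G, IsOfFinOrder x → x = 1) (i : ℕ) :
    ∀ (x : G) (k : ℕ), 0 < k → x ∈ Subgroup.upperCentralSeries G (i + 1) →
      x ^ k ∈ Subgroup.upperCentralSeries G i → x ∈ Subgroup.upperCentralSeries G i := by
  induction i with
  | zero =>
    intro x k hk _ h
    rw [Subgroup.upperCentralSeries_zero, Subgroup.mem_bot] at h ⊢
    exact htf x (isOfFinOrder_iff_pow_eq_one.2 ⟨k, hk, h⟩)
  | succ i ih =>
    intro x k hk hx h
    have comm : ∀ z ∈ Subgroup.upperCentralSeries G (i + 1), ∀ y : G,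
        Commute (z : G ⧸ Subgroup.upperCentralSeries G i) (y : G ⧸ _) := by
      intro z hz y
      rw [← commutatorElement_eq_one_iff_commute]
      exact (QuotientGroup.eq_one_iff (N := Subgroup.upperCentralSeries G i) ⁅z, y⁆).2
        (Subgroup.mem_upperCentralSeries_succ_iff.1 hz y)
    rw [Subgroup.mem_upperCentralSeries_succ_iff] at hx ⊢
    intro g
    have hg := hx g
    refine ih _ k hk hg ?_
    rw [← QuotientGroup.eq_one_iff]
    exact commutator_pow_eq_one (x := (x : G ⧸ Subgroup.upperCentralSeries G i))
      (g := (g : G ⧸ _)) (comm _ hg x) (comm _ h g)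

theorem mem_center_of_pow_mem_center [Group.IsNilpotent G]
    (htf : ∀ x : G, IsOfFinOrder x → x = 1) {x : G} {k : ℕ} (hk : 0 < k)
    (h : x ^ k ∈ Subgroup.center G) : x ∈ Subgroup.center G := by
  have key : ∀ i : ℕ, x ∈ Subgroup.upperCentralSeries G (i + 1) →
      x ∈ Subgroup.upperCentralSeries G 1 := by
    intro i
    induction i with
    | zero => exact id
    | succ i ih =>
      intro hx
      refine ih (mem_upperCentralSeries_of_pow_mem htf _ x k hk hx ?_)
      rw [← Subgroup.upperCentralSeries_one] at h
      exact Subgroup.upperCentralSeries_mono G (Nat.le_add_left 1 i) h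
  obtain ⟨n, hn⟩ := ‹Group.IsNilpotent G›.nilpotent
  rw [← Subgroup.upperCentralSeries_one]
  refine key n (Subgroup.upperCentralSeries_mono G (Nat.le_succ n) ?_)
  rw [hn]
  exact Subgroup.mem_top x

theorem commutator_mem_isolator_succ {n : ℕ} {x : G} (hx : x ∈ isolator G n) (g : G) :
    ⁅x, g⁆ ∈ isolator G (n + 1) := by
  have hle : (⊤ : Subgroup G).lowerCentralSeries (n + 1) ≤ isolator G (n + 1) :=
    fun y hy => ⟨1, one_pos, by simpa using hy⟩
  have hnil : Group.IsNilpotent (G ⧸ isolator G (n + 1)) := by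
    rw [Subgroup.nilpotent_iff_lowerCentralSeries]
    refine ⟨n + 1, ?_⟩
    rw [← Subgroup.map_top_of_surjective (QuotientGroup.mk' (isolator G (n + 1)))
      (QuotientGroup.mk'_surjective _), ← Subgroup.map_lowerCentralSeries, eq_bot_iff]
    rintro _ ⟨y, hy, rfl⟩
    exact (QuotientGroup.eq_one_iff (N := isolator G (n + 1)) y).2 (hle hy)
  have htf : ∀ y : G ⧸ isolator G (n + 1), IsOfFinOrder y → y = 1 := by
    intro y
    induction y using QuotientGroup.induction_on with
    | H y =>
      intro hy
      obtain ⟨k, hk, h⟩ := isOfFinOrder_iff_pow_eq_one.1 hy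
      rw [← QuotientGroup.mk_pow, QuotientGroup.eq_one_iff] at h
      exact (QuotientGroup.eq_one_iff _).2 (mem_isolator_of_pow_mem hk h)
  obtain ⟨k, hk, h⟩ := hx
  have hc : (x : G ⧸ isolator G (n + 1)) ∈ Subgroup.center _ := by
    refine mem_center_of_pow_mem_center htf hk ?_
    rw [Subgroup.mem_center_iff]
    intro y
    induction y using QuotientGroup.induction_on with
    | H y =>
      refine Eq.symm ?_
      change Commute _ _
      rw [← commutatorElement_eq_one_iff_commute]
      refine (QuotientGroup.eq_one_iff (N := isolator G (n + 1)) ⁅x ^ k, y⁆).2 (hle ?_)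
      exact Subgroup.commutator_mem_commutator h (Subgroup.mem_top y)
  rw [← QuotientGroup.eq_one_iff]
  exact commutatorElement_eq_one_iff_commute.2 (Subgroup.mem_center_iff.1 hc g).symm

variable (G) in
/-- `G` is residually torsion-free nilpotent: it has a descending series of normal subgroups
with torsion-free nilpotent quotients and trivial intersection. -/
def IsResiduallyTorsionFreeNilpotent : Prop :=
  ∃ N : ℕ → Subgroup G, N 0 = ⊤ ∧ Antitone N ∧
    (∀ n, ∃ _ : (N n).Normal, Group.IsNilpotent (G ⧸ N n) ∧
      ∀ x : G ⧸ N n, IsOfFinOrder x → x = 1) ∧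
    ⨅ n, N n = ⊥

theorem IsResiduallyTorsionFreeNilpotent.exists_notMem_isolator
    (hG : IsResiduallyTorsionFreeNilpotent G) {x : G} (hx : x ≠ 1) : ∃ n, x ∉ isolator G n := by
  obtain ⟨N, -, -, hN, hbot⟩ := hG
  by_contra! h
  refine hx ?_
  rw [← Subgroup.mem_bot, ← hbot, Subgroup.mem_iInf]
  intro i
  obtain ⟨_, hnil, htf⟩ := hN i
  obtain ⟨n, hn⟩ := Subgroup.nilpotent_iff_lowerCentralSeries.1 hnil
  obtain ⟨k, hk, hk'⟩ := h n
  rw [← QuotientGroup.eq_one_iff]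
  refine htf _ (isOfFinOrder_iff_pow_eq_one.2 ⟨k, hk, ?_⟩)
  rw [← Subgroup.map_top_of_surjective (QuotientGroup.mk' (N i)) (QuotientGroup.mk'_surjective _),
    ← Subgroup.map_lowerCentralSeries] at hn
  rw [← QuotientGroup.mk_pow, ← Subgroup.mem_bot, ← hn]
  exact ⟨_, hk', rfl⟩

end Isolators

/-! ### Bi-invariant orders -/

/-- A total order on a group that is invariant under left and right multiplication. -/
structure BiOrder (G : Type*) [Group G] extends LinearOrder G where
  mul_le_mul_left_of_le : ∀ a b c : G, a ≤ b → c * a ≤ c * b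
  mul_le_mul_right_of_le : ∀ a b c : G, a ≤ b → a * c ≤ b * c

/-- A subset of a group is well-ordered for the bi-invariant order `o`. -/
def BiOrder.WellOrdered {G : Type*} [Group G] (o : BiOrder G) (s : Set G) : Prop :=
  letI := o.toLinearOrder
  s.IsWF

section IsolatorOrder

open scoped commutatorElement

variable {G : Type*} [Group G]

variable (G) in
/-- The successive quotients of the series of isolators. -/
abbrev IsolatorQuotient (n : ℕ) : Type _ :=
  isolator G n ⧸ (isolator G (n + 1)).subgroupOf (isolator G n)

/-- The positive elements of `G`, for given orders on the successive quotients of the series of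
isolators: `x` is positive if `x` belongs to the `n`-th isolator but not to the next one, and its
class in the `n`-th quotient is positive. -/
def IsolatorPos (P : ∀ n, BiOrder (IsolatorQuotient G n)) (x : G) : Prop :=
  ∃ (n : ℕ) (hx : x ∈ isolator G n), x ∉ isolator G (n + 1) ∧
    (P n).lt 1 (QuotientGroup.mk ⟨x, hx⟩)

theorem isolatorQuotient_mk_eq {n : ℕ} {x y : G} (hx : x ∈ isolator G n) (hy : y ∈ isolator G n)
    (h : x⁻¹ * y ∈ isolator G (n + 1)) :
    (QuotientGroup.mk ⟨x, hx⟩ : IsolatorQuotient G n) = QuotientGroup.mk ⟨y, hy⟩ :=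
  QuotientGroup.eq.2 (Subgroup.mem_subgroupOf.2 h)

theorem isolatorQuotient_mk_eq_one {n : ℕ} {x : G} (hx : x ∈ isolator G n) :
    (QuotientGroup.mk ⟨x, hx⟩ : IsolatorQuotient G n) = 1 ↔ x ∈ isolator G (n + 1) := by
  rw [QuotientGroup.eq_one_iff, Subgroup.mem_subgroupOf]

variable {P : ∀ n, BiOrder (IsolatorQuotient G n)}

theorem isolatorPos_intro {n : ℕ} {x : G} (hx : x ∈ isolator G n)
    (h : (P n).lt 1 (QuotientGroup.mk ⟨x, hx⟩)) : IsolatorPos P x := by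
  refine ⟨n, hx, fun hx' => ?_, h⟩
  rw [(isolatorQuotient_mk_eq_one hx).2 hx'] at h
  let _ := (P n).toLinearOrder
  exact lt_irrefl _ h

theorem not_isolatorPos_one : ¬ IsolatorPos P 1 := by
  rintro ⟨n, -, h, -⟩
  exact h (Subgroup.one_mem _)

theorem IsolatorPos.conj {x : G} (h : IsolatorPos P x) (g : G) : IsolatorPos P (g * x * g⁻¹) := by
  obtain ⟨n, hx, -, h⟩ := h
  have hx' : g * x * g⁻¹ ∈ isolator G n := Subgroup.Normal.conj_mem inferInstance _ hx g
  refine isolatorPos_intro hx' ?_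
  rw [← isolatorQuotient_mk_eq hx hx']
  · exact h
  · have := commutator_mem_isolator_succ (Subgroup.inv_mem _ hx) g
    rw [commutatorElement_def, inv_inv] at this
    simpa [mul_assoc] using this

theorem IsolatorPos.mul {x y : G} (hx : IsolatorPos P x) (hy : IsolatorPos P y) :
    IsolatorPos P (x * y) := by
  obtain ⟨n, hxn, hxn', hx⟩ := hx
  obtain ⟨m, hym, hym', hy⟩ := hy
  rcases lt_trichotomy n m with hnm | rfl | hnm
  · have hy1 : y ∈ isolator G (n + 1) := isolator_antitone hnm hym
    have hyn : y ∈ isolator G n := isolator_antitone hnm.le hym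
    refine isolatorPos_intro (Subgroup.mul_mem _ hxn hyn) ?_
    rw [← isolatorQuotient_mk_eq hxn]
    · exact hx
    · simpa using hy1
  · refine isolatorPos_intro (Subgroup.mul_mem _ hxn hym) ?_
    let _ := (P n).toLinearOrder
    have h1 : (QuotientGroup.mk ⟨x, hxn⟩ : IsolatorQuotient G n) * 1 ≤
        QuotientGroup.mk ⟨x, hxn⟩ * QuotientGroup.mk ⟨y, hym⟩ :=
      (P n).mul_le_mul_left_of_le _ _ _ (le_of_lt hy)
    rw [mul_one] at h1
    exact lt_of_lt_of_le hx h1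
  · have hx1 : x ∈ isolator G (m + 1) := isolator_antitone hnm hxn
    have hxm : x ∈ isolator G m := isolator_antitone hnm.le hxn
    refine isolatorPos_intro (Subgroup.mul_mem _ hxm hym) ?_
    rw [← isolatorQuotient_mk_eq hym]
    · exact hy
    · have := Subgroup.Normal.conj_mem (isolator_normal (G := G) (m + 1)) _ hx1 y⁻¹
      simpa [mul_assoc] using this

theorem isolatorPos_or_inv (hG : IsResiduallyTorsionFreeNilpotent G) {x : G} (hx : x ≠ 1) :
    IsolatorPos P x ∨ IsolatorPos P x⁻¹ := by
  classical
  have hex := hG.exists_notMem_isolator hx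
  obtain ⟨n, hn⟩ : ∃ n, Nat.find hex = n + 1 := by
    refine Nat.exists_eq_succ_of_ne_zero fun h0 => ?_
    have := Nat.find_spec hex
    rw [h0, isolator_zero] at this
    exact this (Subgroup.mem_top x)
  have hxn1 : x ∉ isolator G (n + 1) := hn ▸ Nat.find_spec hex
  have hxn : x ∈ isolator G n := not_not.1 (Nat.find_min hex (m := n) (by omega))
  let _ := (P n).toLinearOrder
  have hne : (QuotientGroup.mk ⟨x, hxn⟩ : IsolatorQuotient G n) ≠ 1 :=
    fun h => hxn1 ((isolatorQuotient_mk_eq_one hxn).1 h)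
  rcases lt_or_gt_of_ne hne with h | h
  · right
    have hinv : x⁻¹ ∈ isolator G n := Subgroup.inv_mem _ hxn
    refine isolatorPos_intro hinv ?_
    have hle := (P n).mul_le_mul_left_of_le _ _ (QuotientGroup.mk ⟨x⁻¹, hinv⟩) (le_of_lt h)
    have he : (QuotientGroup.mk ⟨x⁻¹, hinv⟩ : IsolatorQuotient G n) * QuotientGroup.mk ⟨x, hxn⟩
        = 1 := inv_mul_cancel (QuotientGroup.mk ⟨x, hxn⟩ : IsolatorQuotient G n)
    rw [he, mul_one] at hle
    refine lt_of_le_of_ne hle fun h1 => hne ?_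
    rw [← h1, one_mul] at he
    exact he
  · exact Or.inl (isolatorPos_intro hxn h)

open Classical in
/-- The bi-invariant order on a residually torsion-free nilpotent group `G` determined by orders on
the successive quotients of the series of isolators: `x < y` if and only if `x⁻¹ * y` is
positive. -/
noncomputable def isolatorOrder (hG : IsResiduallyTorsionFreeNilpotent G)
    (P : ∀ n, BiOrder (IsolatorQuotient G n)) : BiOrder G where
  le x y := x = y ∨ IsolatorPos P (x⁻¹ * y)
  lt x y := IsolatorPos P (x⁻¹ * y)
  le_refl x := Or.inl rfl
  le_trans x y z := by
    rintro (rfl | hxy) (rfl | hyz)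
    · exact Or.inl rfl
    · exact Or.inr hyz
    · exact Or.inr hxy
    · right
      have := hxy.mul hyz
      simpa [mul_assoc] using this
  lt_iff_le_not_ge x y := by
    constructor
    · intro h
      refine ⟨Or.inr h, ?_⟩
      rintro (rfl | h')
      · rw [inv_mul_cancel] at h
        exact not_isolatorPos_one h
      · have := h.mul h'
        refine not_isolatorPos_one (P := P) ?_
        simpa [mul_assoc] using this
    · rintro ⟨rfl | h, h'⟩
      · exact absurd (Or.inl rfl) h'
      · exact h
  le_antisymm x y := by
    rintro (rfl | hxy) (h | hyx)
    · rfl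
    · rfl
    · exact h.symm
    · have := hxy.mul hyx
      refine absurd ?_ (not_isolatorPos_one (P := P))
      simpa [mul_assoc] using this
  le_total x y := by
    by_cases h : x = y
    · exact Or.inl (Or.inl h)
    · rcases isolatorPos_or_inv (P := P) hG (x := x⁻¹ * y)
        (fun h1 => h (inv_mul_eq_one.1 h1)) with h1 | h1
      · exact Or.inl (Or.inr h1)
      · exact Or.inr (Or.inr (by simpa using h1))
  toDecidableLE := Classical.decRel _
  mul_le_mul_left_of_le a b c := by
    rintro (rfl | h)
    · exact Or.inl rfl
    · exact Or.inr (by simpa [mul_assoc] using h)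
  mul_le_mul_right_of_le a b c := by
    rintro (rfl | h)
    · exact Or.inl rfl
    · exact Or.inr (by simpa [mul_assoc] using h.conj c⁻¹)

end IsolatorOrder

/-! ### The Mal'cev–Neumann completion -/

section WellOrdered

open scoped Pointwise

variable {G : Type*} [Group G] (o : BiOrder G)

theorem BiOrder.WellOrdered.mono {o : BiOrder G} {s t : Set G} (ht : o.WellOrdered t)
    (h : s ⊆ t) : o.WellOrdered s := by
  let _ := o.toLinearOrder
  exact Set.IsWF.mono ht h

theorem BiOrder.WellOrdered.union {o : BiOrder G} {s t : Set G} (hs : o.WellOrdered s)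
    (ht : o.WellOrdered t) : o.WellOrdered (s ∪ t) := by
  let _ := o.toLinearOrder
  exact Set.IsWF.union hs ht

theorem BiOrder.wellOrdered_of_finite {s : Set G} (hs : s.Finite) : o.WellOrdered s := by
  let _ := o.toLinearOrder
  exact hs.isWF

theorem BiOrder.WellOrdered.mul {o : BiOrder G} {s t : Set G} (hs : o.WellOrdered s)
    (ht : o.WellOrdered t) : o.WellOrdered (s * t) := by
  let _ := o.toLinearOrder
  have hs' : s.IsPWO := Set.IsWF.isPWO hs
  have ht' : t.IsPWO := Set.IsWF.isPWO ht
  have h : (s * t).IsPWO := by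
    rw [← Set.image_mul_prod]
    refine (hs'.prod ht').image_of_monotone ?_
    rintro ⟨a, b⟩ ⟨c, d⟩ ⟨h1, h2⟩
    exact le_trans (o.mul_le_mul_right_of_le a c b h1) (o.mul_le_mul_left_of_le b d c h2)
  exact h.isWF

theorem BiOrder.WellOrdered.finite_setOf_mem {o : BiOrder G} {s t : Set G} (hs : o.WellOrdered s)
    (ht : o.WellOrdered t) (g : G) : {a | a ∈ s ∧ a⁻¹ * g ∈ t}.Finite := by
  let _ := o.toLinearOrder
  have : MulLeftMono G := ⟨fun c a b h => o.mul_le_mul_left_of_le a b c h⟩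
  have : MulRightMono G := ⟨fun c a b h => o.mul_le_mul_right_of_le a b c h⟩
  have hs' : s.IsPWO := Set.IsWF.isPWO hs
  by_contra hinf
  have hinf : {a | a ∈ s ∧ a⁻¹ * g ∈ t}.Infinite := hinf
  obtain ⟨φ, hφ⟩ := hs'.exists_monotone_subseq (f := fun n => (hinf.natEmbedding _ n : G))
    (fun n => (hinf.natEmbedding _ n).2.1)
  have ht' : t.IsPWO := Set.IsWF.isPWO ht
  obtain ⟨m, n, hmn, hle⟩ := ht' fun n => ⟨_, (hinf.natEmbedding _ (φ n)).2.2⟩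
  have h1 : (hinf.natEmbedding _ (φ m) : G) ≤ hinf.natEmbedding _ (φ n) := hφ hmn.le
  have h2 : (hinf.natEmbedding _ (φ n) : G) ≤ hinf.natEmbedding _ (φ m) := by
    have hle' := (mul_le_mul_iff_right g).1 hle
    exact inv_le_inv_iff.1 hle'
  have h3 := (hinf.natEmbedding _).injective (Subtype.ext (le_antisymm h1 h2))
  exact hmn.ne (φ.injective h3)

end WellOrdered

/-- The Mal'cev–Neumann completion `K⟨G⟩`: formal series on `G` with coefficients in `K` whose
support is well-ordered for the bi-invariant order `o` on `G`. -/
@[ext]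
structure MalcevNeumann (K : Type*) [DivisionRing K] {G : Type*} [Group G] (o : BiOrder G) where
  /-- The coefficients of a series. -/
  coeff : G → K
  wellOrdered_support : o.WellOrdered (Function.support coeff)

namespace MalcevNeumann

open scoped Pointwise

variable {K : Type*} [DivisionRing K] {G : Type*} [Group G] {o : BiOrder G}

theorem finite_support_mul (x y : MalcevNeumann K o) (g : G) :
    (Function.support fun a => x.coeff a * y.coeff (a⁻¹ * g)).Finite :=
  (x.wellOrdered_support.finite_setOf_mem y.wellOrdered_support g).subset fun _ ha =>
    ⟨left_ne_zero_of_mul ha, right_ne_zero_of_mul ha⟩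

theorem support_mul_subset (x y : MalcevNeumann K o) :
    (Function.support fun g => ∑ᶠ a, x.coeff a * y.coeff (a⁻¹ * g)) ⊆
      Function.support x.coeff * Function.support y.coeff := by
  intro g hg
  obtain ⟨a, ha⟩ : ∃ a, x.coeff a * y.coeff (a⁻¹ * g) ≠ 0 := by
    by_contra! h
    exact hg (finsum_eq_zero_of_forall_eq_zero h)
  exact ⟨a, left_ne_zero_of_mul ha, _, right_ne_zero_of_mul ha, mul_inv_cancel_left a g⟩

instance : Zero (MalcevNeumann K o) :=
  ⟨⟨fun _ => 0, o.wellOrdered_of_finite (by simp)⟩⟩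

open Classical in
noncomputable instance : One (MalcevNeumann K o) :=
  ⟨⟨fun g => if g = 1 then 1 else 0, o.wellOrdered_of_finite
    ((Set.finite_singleton (1 : G)).subset fun g hg => by
      by_contra h
      exact hg (if_neg h))⟩⟩

instance : Add (MalcevNeumann K o) :=
  ⟨fun x y => ⟨fun g => x.coeff g + y.coeff g,
    (x.wellOrdered_support.union y.wellOrdered_support).mono (Function.support_add _ _)⟩⟩

instance : Neg (MalcevNeumann K o) :=
  ⟨fun x => ⟨fun g => - x.coeff g, x.wellOrdered_support.mono fun _ hg => neg_ne_zero.1 hg⟩⟩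

/-- The convolution product: the coefficient of `g` is the sum of `x a * y b` over the (finitely
many) pairs `(a, b)` of elements of the supports with `a * b = g`. -/
noncomputable instance : Mul (MalcevNeumann K o) :=
  ⟨fun x y => ⟨fun g => ∑ᶠ a, x.coeff a * y.coeff (a⁻¹ * g),
    (x.wellOrdered_support.mul y.wellOrdered_support).mono (support_mul_subset x y)⟩⟩

theorem coeff_zero (g : G) : (0 : MalcevNeumann K o).coeff g = 0 := rfl

theorem coeff_add (x y : MalcevNeumann K o) (g : G) :
    (x + y).coeff g = x.coeff g + y.coeff g := rfl

theorem coeff_neg (x : MalcevNeumann K o) (g : G) : (-x).coeff g = - x.coeff g := rfl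

theorem coeff_mul (x y : MalcevNeumann K o) (g : G) :
    (x * y).coeff g = ∑ᶠ a, x.coeff a * y.coeff (a⁻¹ * g) := rfl

theorem coeff_one_one : (1 : MalcevNeumann K o).coeff 1 = 1 := if_pos rfl

theorem coeff_one_of_ne {g : G} (h : g ≠ 1) : (1 : MalcevNeumann K o).coeff g = 0 := if_neg h

protected theorem mul_assoc (x y z : MalcevNeumann K o) : x * y * z = x * (y * z) := by
  ext g
  have hfin : (Function.support fun p : G × G =>
      x.coeff p.1 * y.coeff (p.1⁻¹ * p.2) * z.coeff (p.2⁻¹ * g)).Finite := by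
    have h1 := (x.wellOrdered_support.mul y.wellOrdered_support).finite_setOf_mem
      z.wellOrdered_support g
    refine (h1.biUnion fun c _ => (x.wellOrdered_support.finite_setOf_mem
      y.wellOrdered_support c).image fun a => (a, c)).subset ?_
    rintro ⟨a, c⟩ h
    have hz := right_ne_zero_of_mul h
    have hxy := left_ne_zero_of_mul h
    have hx := left_ne_zero_of_mul hxy
    have hy := right_ne_zero_of_mul hxy
    refine Set.mem_biUnion (x := c) ⟨⟨a, hx, _, hy, mul_inv_cancel_left a c⟩, hz⟩ ?_
    exact ⟨a, ⟨hx, hy⟩, rfl⟩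
  have hfin' : (Function.support fun p : G × G =>
      x.coeff p.2 * y.coeff (p.2⁻¹ * p.1) * z.coeff (p.1⁻¹ * g)).Finite :=
    (hfin.image Prod.swap).subset fun p hp => ⟨p.swap, hp, Prod.swap_swap p⟩
  calc (x * y * z).coeff g
      = ∑ᶠ c, ∑ᶠ a, x.coeff a * y.coeff (a⁻¹ * c) * z.coeff (c⁻¹ * g) := by
        rw [coeff_mul]
        refine finsum_congr fun c => ?_
        rw [coeff_mul, finsum_mul]
    _ = ∑ᶠ p : G × G, x.coeff p.2 * y.coeff (p.2⁻¹ * p.1) * z.coeff (p.1⁻¹ * g) :=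
        (finsum_curry _ hfin').symm
    _ = ∑ᶠ p : G × G, x.coeff p.1 * y.coeff (p.1⁻¹ * p.2) * z.coeff (p.2⁻¹ * g) :=
        finsum_eq_of_bijective Prod.swap Prod.swap_bijective fun _ => rfl
    _ = ∑ᶠ a, ∑ᶠ c, x.coeff a * y.coeff (a⁻¹ * c) * z.coeff (c⁻¹ * g) := finsum_curry _ hfin
    _ = (x * (y * z)).coeff g := by
        rw [coeff_mul]
        refine finsum_congr fun a => ?_
        rw [coeff_mul, mul_finsum]
        refine finsum_eq_of_bijective (fun c => a⁻¹ * c) (Group.mulLeft_bijective a⁻¹) fun c => ?_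
        simp [mul_assoc]

noncomputable instance : Ring (MalcevNeumann K o) where
  add_assoc x y z := by ext g; exact add_assoc _ _ _
  zero_add x := by ext g; exact zero_add _
  add_zero x := by ext g; exact add_zero _
  add_comm x y := by ext g; exact add_comm _ _
  neg_add_cancel x := by ext g; exact neg_add_cancel _
  nsmul := nsmulRec
  zsmul := zsmulRec
  left_distrib x y z := by
    ext g
    simp only [coeff_mul, coeff_add, mul_add]
    exact finsum_add_distrib (finite_support_mul x y g) (finite_support_mul x z g)
  right_distrib x y z := by
    ext g
    simp only [coeff_mul, coeff_add, add_mul]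
    exact finsum_add_distrib (finite_support_mul x z g) (finite_support_mul y z g)
  zero_mul x := by
    ext g
    simp [coeff_mul, coeff_zero]
  mul_zero x := by
    ext g
    simp [coeff_mul, coeff_zero]
  mul_assoc := MalcevNeumann.mul_assoc
  one_mul x := by
    ext g
    rw [coeff_mul, finsum_eq_single _ 1 fun a ha => by rw [coeff_one_of_ne ha, zero_mul]]
    simp [coeff_one_one]
  mul_one x := by
    ext g
    rw [coeff_mul, finsum_eq_single _ g fun a ha => by
      rw [coeff_one_of_ne (fun h => ha (inv_mul_eq_one.1 h)), mul_zero]]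
    simp [coeff_one_one]

end MalcevNeumann

/-! ### Series with controlled support -/

/-- For a subgroup `N` of `G`, the set `K[N]⟨G/N⟩` of formal series `∑ t ∈ T, c t * t` on `G`, where
`T` is a well-ordered subset of a transversal `R` of `N` in `G` and every `c t` belongs to the
group algebra `K[N]`: the coefficient of `h * t` is that of `h` in `c t` if `t ∈ T` and `h ∈ N`,
and the coefficients of the elements outside `N * T` vanish. -/
def controlledSeries (K : Type*) [DivisionRing K] {G : Type*} [Group G] (o : BiOrder G)
    (N : Subgroup G) : Set (G → K) :=
  {f | ∃ (R T : Set G) (c : G → MonoidAlgebra K N),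
    Subgroup.IsComplement (N : Set G) R ∧ T ⊆ R ∧ o.WellOrdered T ∧
    (∀ t ∈ T, ∀ h : N, f (h * t) = (c t).coeff h) ∧
    ∀ g : G, (∀ t ∈ T, ∀ h : N, g ≠ h * t) → f g = 0}

/-- The set `S(G)`: the union of the sets `ℚ[Gₙ]⟨G/Gₙ⟩`, where `Gₙ` runs over the isolators of the
terms of the lower central series, starting from `G` itself. -/
def eizenbudLichtman {G : Type*} [Group G] (o : BiOrder G) : Set (G → ℚ) :=
  ⋃ n : ℕ, controlledSeries ℚ o (isolator G n)

/-! ### Partially well-ordered sets in partially ordered groups -/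

section PartiallyOrderedGroup

open scoped Pointwise

variable {G : Type*} [Group G] [PartialOrder G] [MulLeftMono G] [MulRightMono G]

/-! Everything is expressed through one condition on supports. For a convex normal subgroup `N`, let
`LEMod N` compare distinct elements only when they lie in different cosets; this is a partial order
invariant under both translations. Series controlled by `N` are exactly those whose support is
partially well-ordered for it (`mem_controlledSeries_iff`), and isolators are convex
(`isConvex_isolator`). Products of partially well-ordered sets are partially well-ordered, and the
condition weakens as `N` shrinks, so the union over the isolators is a subring. For inverses, a
nonzero element of `ℚ[Gₙ]` need not be invertible at level `n`, so the level has to change. The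
leading coset of `Gₙ` meets the support in finitely many elements; since the isolators intersect
trivially, some deeper `Gₘ` separates them all from the least one, `g`. Modulo `Gₘ` the series is `c
* g * (1 - z)`, with `z` supported on elements strictly above `1`, and Higman's lemma makes the
geometric series in `z` a controlled series at level `m` (`exists_mul_one_sub_eq_one`). -/

theorem List.SublistForall₂.prod_lt_prod_of_length_lt {l₁ l₂ : List G}
    (h : List.SublistForall₂ (· ≤ ·) l₁ l₂) (hpos : ∀ a ∈ l₂, 1 < a)
    (hlen : l₁.length < l₂.length) : l₁.prod < l₂.prod := by
  induction h with
  | nil =>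
    rename_i l
    cases l with
    | nil => simp at hlen
    | cons a l =>
      rw [List.prod_nil, List.prod_cons]
      exact lt_mul_of_lt_of_one_le (hpos a (by simp))
        (List.one_le_prod_of_one_le fun b hb => (hpos b (by simp [hb])).le)
  | cons hab _ ih =>
    rw [List.prod_cons, List.prod_cons]
    exact mul_lt_mul_of_le_of_lt hab
      (ih (fun c hc => hpos c (by simp [hc])) (by simpa using hlen))
  | cons_right h ih =>
    rw [List.prod_cons]
    -- The remaining lists may have equal lengths, so they give only a weak inequality; strictness
    -- comes from the skipped factor, which exceeds `1`.
    refine (h.prod_le_prod' fun b hb => (hpos b (by simp [hb])).le).trans_lt ?_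
    exact lt_mul_of_one_lt_left' _ (hpos _ (by simp))

theorem Set.IsPWO.mul_of_mulMono {s t : Set G} (hs : s.IsPWO) (ht : t.IsPWO) :
    (s * t).IsPWO := by
  rw [← Set.image_mul_prod]
  refine (hs.prod ht).image_of_monotone ?_
  rintro ⟨a, b⟩ ⟨c, d⟩ ⟨h1, h2⟩
  exact mul_le_mul' h1 h2

/-- Higman's lemma makes words over `s` partially well-ordered under embedding. The product is
monotone for embedding, because inserted letters are at least `1` and multiplication is monotone on
both sides; commutativity plays no role. -/
theorem Set.IsPWO.submonoid_closure_of_mulMono {s : Set G} (hpos : ∀ x ∈ s, 1 ≤ x)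
    (h : s.IsPWO) : (Submonoid.closure s : Set G).IsPWO := by
  rw [Submonoid.closure_eq_image_prod]
  refine (h.partiallyWellOrderedOn_sublistForall₂ (· ≤ ·)).image_of_monotone_on ?_
  exact fun l1 _ l2 hl2 h12 => h12.prod_le_prod' fun x hx => hpos x <| hl2 x hx

/-- An element has factorizations of boundedly many lengths only over a partially well-ordered set
of elements greater than `1`. -/
theorem Set.IsPWO.finite_setOf_length {s : Set G} (hpos : ∀ x ∈ s, 1 < x) (h : s.IsPWO) (g : G) :
    {k | ∃ l : List G, (∀ x ∈ l, x ∈ s) ∧ l.prod = g ∧ l.length = k}.Finite := by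
  by_contra hinf
  have hinf : Set.Infinite _ := hinf
  -- Take factorizations of `g` of strictly increasing lengths. Higman's lemma embeds one in a
  -- later, longer one, whose product would then be strictly larger.
  choose l hl using fun n => Nat.nth_mem_of_infinite hinf n
  obtain ⟨m, n, hmn, hle⟩ :=
    (h.partiallyWellOrderedOn_sublistForall₂ (· ≤ ·)).exists_lt fun n => (hl n).1
  refine (hle.prod_lt_prod_of_length_lt (fun a ha => hpos a ((hl n).1 a ha)) ?_).ne ?_
  · rw [(hl m).2.2, (hl n).2.2]
    exact Nat.nth_strictMono hinf hmn
  · rw [(hl m).2.1, (hl n).2.1]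

end PartiallyOrderedGroup

/-! ### The order modulo a convex normal subgroup -/

namespace BiOrder

open scoped Pointwise

variable {G : Type*} [Group G] {o : BiOrder G}

variable (o) in
/-- A subgroup `N` is convex if every element between `1` and an element of `N` is in `N`. -/
def IsConvex (N : Subgroup G) : Prop :=
  ∀ x y : G, o.le 1 x → o.le x y → y ∈ N → x ∈ N

variable (o) in
/-- The relation on `G` whose strict part is the pullback of the strict order on `G ⧸ N`, for a
convex normal subgroup `N`. -/
def LEMod (N : Subgroup G) (x y : G) : Prop := x = y ∨ (o.lt x y ∧ x⁻¹ * y ∉ N)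

variable (o) in
/-- A set of elements of `G` that is partially well-ordered for the relation `LEMod`. If `N` is
normal and convex, this means that the set has a well-ordered image in `G ⧸ N` and finite
intersections with the cosets of `N`. -/
def PWOMod (N : Subgroup G) (s : Set G) : Prop := s.PartiallyWellOrderedOn (o.LEMod N)

theorem mulLeftMono : letI := o.toLinearOrder; MulLeftMono G :=
  letI := o.toLinearOrder
  ⟨fun c a b h => o.mul_le_mul_left_of_le a b c h⟩

theorem mulRightMono : letI := o.toLinearOrder; MulRightMono G :=
  letI := o.toLinearOrder
  ⟨fun c a b h => o.mul_le_mul_right_of_le a b c h⟩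

theorem lt_mul_left {x y : G} (h : o.lt x y) (c : G) : o.lt (c * x) (c * y) := by
  let _ := o.toLinearOrder
  have := o.mulLeftMono
  exact mul_lt_mul_right (α := G) h c

theorem lt_mul_right {x y : G} (h : o.lt x y) (c : G) : o.lt (x * c) (y * c) := by
  let _ := o.toLinearOrder
  have := o.mulRightMono
  exact mul_lt_mul_left (α := G) h c

variable {N : Subgroup G}

theorem LEMod.le {x y : G} (h : o.LEMod N x y) : o.le x y := by
  let _ := o.toLinearOrder
  rcases h with rfl | h
  · exact le_refl x
  · exact le_of_lt (α := G) h.1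

/-- Convexity is what is needed: if `x⁻¹ * z` were in `N`, then `x⁻¹ * y`, which lies between `1`
and it, would be too. -/
theorem LEMod.trans (hN : o.IsConvex N) {x y z : G} (hxy : o.LEMod N x y)
    (hyz : o.LEMod N y z) : o.LEMod N x z := by
  let _ := o.toLinearOrder
  rcases hxy with rfl | ⟨hxy, hxy'⟩
  · exact hyz
  rcases hyz with rfl | ⟨hyz, hyz'⟩
  · exact Or.inr ⟨hxy, hxy'⟩
  refine Or.inr ⟨lt_trans (α := G) hxy hyz, fun h => hxy' (hN _ _ ?_ ?_ h)⟩
  · have := o.lt_mul_left hxy x⁻¹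
    rw [inv_mul_cancel] at this
    exact le_of_lt (α := G) this
  · exact le_of_lt (α := G) (o.lt_mul_left hyz x⁻¹)

theorem LEMod.mul_left {x y : G} (h : o.LEMod N x y) (c : G) : o.LEMod N (c * x) (c * y) := by
  rcases h with rfl | ⟨h, h'⟩
  · exact Or.inl rfl
  · exact Or.inr ⟨o.lt_mul_left h c, by simpa [mul_assoc] using h'⟩

theorem LEMod.mul_right [hn : N.Normal] {x y : G} (h : o.LEMod N x y) (c : G) :
    o.LEMod N (x * c) (y * c) := by
  rcases h with rfl | ⟨h, h'⟩
  · exact Or.inl rfl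
  · refine Or.inr ⟨o.lt_mul_right h c, fun h1 => h' ?_⟩
    have := hn.conj_mem _ h1 c
    simpa [mul_assoc] using this

/-- `LEMod` as a partial order. -/
@[reducible]
def modOrder (hN : o.IsConvex N) : PartialOrder G where
  le := o.LEMod N
  le_refl _ := Or.inl rfl
  le_trans _ _ _ := LEMod.trans hN
  le_antisymm _ _ h h' := by
    let _ := o.toLinearOrder
    exact le_antisymm (α := G) h.le h'.le

theorem modOrder_mulLeftMono (hN : o.IsConvex N) : letI := modOrder hN; MulLeftMono G :=
  letI := modOrder hN
  ⟨fun c _ _ h => LEMod.mul_left h c⟩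

theorem modOrder_mulRightMono [N.Normal] (hN : o.IsConvex N) :
    letI := modOrder hN; MulRightMono G :=
  letI := modOrder hN
  ⟨fun c _ _ h => LEMod.mul_right h c⟩

theorem LEMod.of_le {M : Subgroup G} (hMN : M ≤ N) {x y : G} (h : o.LEMod N x y) :
    o.LEMod M x y :=
  h.imp_right fun h => ⟨h.1, fun h' => h.2 (hMN h')⟩

/-- A smaller subgroup makes more pairs comparable. Hence controlled supports stay controlled at
deeper levels, and two series can be brought to a common level. -/
theorem PWOMod.of_le {M : Subgroup G} (hMN : M ≤ N) {s : Set G} (hs : o.PWOMod N s) :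
    o.PWOMod M s :=
  partiallyWellOrderedOn_iff_exists_lt.2 fun _ hf =>
    let ⟨m, n, hmn, h⟩ := hs.exists_lt hf
    ⟨m, n, hmn, h.of_le hMN⟩

theorem PWOMod.wellOrdered {s : Set G} (hs : o.PWOMod N s) : o.WellOrdered s := by
  let _ := o.toLinearOrder
  have : s.IsPWO := partiallyWellOrderedOn_iff_exists_lt.2 fun _ hf =>
    let ⟨m, n, hmn, h⟩ := hs.exists_lt hf
    ⟨m, n, hmn, h.le⟩
  exact this.isWF

theorem PWOMod.mono {s t : Set G} (ht : o.PWOMod N t) (h : s ⊆ t) : o.PWOMod N s :=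
  PartiallyWellOrderedOn.mono ht h

theorem PWOMod.mul [N.Normal] (hN : o.IsConvex N) {s t : Set G} (hs : o.PWOMod N s)
    (ht : o.PWOMod N t) : o.PWOMod N (s * t) := by
  let _ := modOrder hN
  have := modOrder_mulLeftMono hN
  have := modOrder_mulRightMono hN
  exact Set.IsPWO.mul_of_mulMono hs ht

theorem pwoMod_of_finite (hN : o.IsConvex N) {s : Set G} (hs : s.Finite) : o.PWOMod N s := by
  let _ := modOrder hN
  exact hs.isPWO

/-- A partially well-ordered set has finite intersections with the cosets of `N`. -/
theorem PWOMod.finite_coset {s : Set G} (hs : o.PWOMod N s) (g : G) :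
    {x | x ∈ s ∧ g⁻¹ * x ∈ N}.Finite := by
  -- Distinct elements of one coset are incomparable, and a partially well-ordered antichain is
  -- finite.
  refine IsAntichain.finite_of_partiallyWellOrderedOn (r := o.LEMod N) ?_ (hs.mono fun x hx => hx.1)
  rintro x ⟨-, hx⟩ y ⟨-, hy⟩ hxy (h | ⟨-, h⟩)
  · exact hxy h
  · refine h ?_
    have := N.mul_mem (N.inv_mem hx) hy
    simpa [mul_assoc] using this

theorem inv_mul_mem_of_mul_eq_mul [hn : N.Normal] {x y h k : G} (hh : h ∈ N) (hk : k ∈ N)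
    (he : h * x = k * y) : x⁻¹ * y ∈ N := by
  have h1 : x⁻¹ * y = x⁻¹ * (h⁻¹ * k)⁻¹ * x⁻¹⁻¹ := by
    have : y = k⁻¹ * (h * x) := by rw [he, inv_mul_cancel_left]
    rw [this]; group
  rw [h1]
  exact hn.conj_mem _ (N.inv_mem (N.mul_mem (N.inv_mem hh) hk)) _

/-- The strict part of `LEMod` only depends on the cosets. -/
theorem LEMod.mul_mem_mul_mem [hn : N.Normal] (hN : o.IsConvex N) {x y h k : G}
    (hxy : o.LEMod N x y) (hne : x ≠ y) (hh : h ∈ N) (hk : k ∈ N) :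
    o.LEMod N (h * x) (k * y) := by
  let _ := o.toLinearOrder
  obtain ⟨hlt, hnot⟩ := hxy.resolve_left hne
  have hconj : ∀ z ∈ N, x⁻¹ * z * x ∈ N := fun z hz => by
    simpa using hn.conj_mem z hz x⁻¹
  refine Or.inr ⟨lt_of_not_ge (α := G) fun hle => hnot ?_, fun hmem => hnot ?_⟩
  -- If `k * y ≤ h * x`, then `1 < y * x⁻¹ ≤ k⁻¹ * h`, and convexity puts `y * x⁻¹` in `N`.
  · have h1 : o.lt 1 (y * x⁻¹) := by
      have := o.lt_mul_right hlt x⁻¹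
      rwa [mul_inv_cancel] at this
    have h2 : o.le (y * x⁻¹) (k⁻¹ * h) := by
      have := o.mul_le_mul_right_of_le _ _ x⁻¹ (o.mul_le_mul_left_of_le _ _ k⁻¹ hle)
      simpa [mul_assoc] using this
    have h3 := hN _ _ (le_of_lt (α := G) h1) h2 (N.mul_mem (N.inv_mem hk) hh)
    simpa [mul_assoc] using hconj _ h3
  -- The multiplier is `y * x⁻¹`, written so that its membership in `N` is visible.
  · refine inv_mul_mem_of_mul_eq_mul (h := k⁻¹ * h * (x * ((h * x)⁻¹ * (k * y)) * x⁻¹)) (k := 1)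
      ?_ N.one_mem (by group)
    exact N.mul_mem (N.mul_mem (N.inv_mem hk) hh) (hn.conj_mem _ hmem x)

end BiOrder

/-! ### Isolators are convex -/

section IsolatorOrder

variable {G : Type*} [Group G] {P : ∀ n, BiOrder (IsolatorQuotient G n)}

/-- The sign of an element outside an isolator only depends on its coset. -/
theorem IsolatorPos.of_inv_mul_mem {n : ℕ} {x y : G} (hx : IsolatorPos P x)
    (hn : x ∉ isolator G n) (hxy : x⁻¹ * y ∈ isolator G n) : IsolatorPos P y := by
  obtain ⟨i, hxi, -, h⟩ := hx
  -- The sign of `x` is read at a level `i < n`, and changing `x` by an element of the `n`-th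
  -- isolator does not affect its class there.
  have hin : i < n := lt_of_not_ge fun hni => hn (isolator_antitone hni hxi)
  have hyi : y ∈ isolator G i := by
    have := Subgroup.mul_mem _ hxi (isolator_antitone hin.le hxy)
    rwa [mul_inv_cancel_left] at this
  refine isolatorPos_intro hyi ?_
  rwa [← isolatorQuotient_mk_eq hxi hyi (isolator_antitone hin hxy)]

/-- If `x` were outside the isolator, `x⁻¹ * y` would be positive and in the same coset as `x⁻¹`, so
`x` and `x⁻¹` would both be positive. -/
theorem isConvex_isolator (hG : IsResiduallyTorsionFreeNilpotent G) (n : ℕ) :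
    (isolatorOrder hG P).IsConvex (isolator G n) := by
  rintro x y h1 hxy hy
  by_contra hx
  have hx1 : IsolatorPos P x := by
    rcases h1 with rfl | h
    · exact absurd (Subgroup.one_mem _) hx
    · simpa using h
  rcases hxy with rfl | hxy
  · exact hx hy
  · have hnot : x⁻¹ * y ∉ isolator G n := fun h =>
      hx (by simpa using Subgroup.mul_mem _ hy (Subgroup.inv_mem _ h))
    have h2 : IsolatorPos P x⁻¹ := by
      refine hxy.of_inv_mul_mem hnot ?_
      simpa [mul_assoc] using Subgroup.inv_mem _ hy
    exact not_isolatorPos_one (P := P) (by simpa using hx1.mul h2)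

end IsolatorOrder

/-! ### Characterization of the controlled series -/

section ControlledSeries

variable {K : Type*} [DivisionRing K] {G : Type*} [Group G] {o : BiOrder G}

/-- This removes the transversal, which is awkward for products and inverses, in favour of an
intrinsic condition on the support. -/
theorem mem_controlledSeries_iff {N : Subgroup G} [hn : N.Normal] (hN : o.IsConvex N) {f : G → K} :
    f ∈ controlledSeries K o N ↔ o.PWOMod N (Function.support f) := by
  constructor
  · rintro ⟨R, T, c, hR, hTR, hT, hc, h0⟩
    refine partiallyWellOrderedOn_iff_exists_lt.2 fun s hs => ?_
    have hex : ∀ i, ∃ t ∈ T, ∃ h : N, s i = h * t := fun i => by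
      by_contra! h
      exact hs i (h0 _ h)
    choose t ht h hsi using hex
    let _ := o.toLinearOrder
    have hT' : T.IsPWO := Set.IsWF.isPWO hT
    obtain ⟨φ, hφ⟩ := hT'.exists_monotone_subseq ht
    -- Distinct representatives lie in distinct cosets, so their order decides that of the terms.
    -- Otherwise all terms lie in one coset, where the finite support of a single group algebra
    -- element forces a repetition.
    by_cases hstrict : ∃ i j, i < j ∧ t (φ i) ≠ t (φ j)
    · obtain ⟨i, j, hij, hne⟩ := hstrict
      refine ⟨φ i, φ j, φ.strictMono hij, ?_⟩
      rw [hsi, hsi]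
      refine BiOrder.LEMod.mul_mem_mul_mem hN (Or.inr ⟨?_, ?_⟩) hne (h _).2 (h _).2
      · exact lt_of_le_of_ne (α := G) (hφ hij.le) hne
      · intro hmem
        have hmem' : t (φ i) * (t (φ j))⁻¹ ∈ N := by
          have := hn.conj_mem _ (N.inv_mem hmem) (t (φ i))
          simpa [mul_assoc] using this
        have := Subgroup.isComplement_iff_existsUnique_mul_inv_mem.1 hR (t (φ i))
        exact hne (congrArg Subtype.val (this.unique (y₁ := ⟨_, hTR (ht (φ i))⟩)
          (y₂ := ⟨_, hTR (ht (φ j))⟩) (by simp) hmem'))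
    · push Not at hstrict
      have hconst : ∀ i, t (φ i) = t (φ 0) := fun i => by
        rcases Nat.eq_zero_or_pos i with rfl | hi
        · rfl
        · exact (hstrict 0 i hi).symm
      have hmem : ∀ i, h (φ i) ∈ ((c (t (φ 0))).coeff.support : Set N) := fun i => by
        rw [Finset.mem_coe, Finsupp.mem_support_iff, ← hc _ (ht _), ← hconst i, ← hsi]
        exact hs _
      obtain ⟨i, j, hij, heq⟩ :=
        ((Finset.finite_toSet _).partiallyWellOrderedOn (r := (· = ·))).exists_lt hmem
      refine ⟨φ i, φ j, φ.strictMono hij, Or.inl ?_⟩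
      rw [hsi, hsi, hconst i, hconst j, heq]
  · intro hf
    -- Any transversal works; the choice of `1` as an element of it is immaterial.
    obtain ⟨R, hR, -⟩ := N.exists_isComplement_right 1
    have hfin : ∀ t : G, (Function.support fun h : N => f (h * t)).Finite := fun t => by
      refine ((hf.finite_coset t).preimage (f := fun h : N => (h : G) * t) ?_).subset ?_
      · intro a _ b _ hab
        exact Subtype.ext (mul_right_cancel hab)
      · intro a ha
        refine ⟨ha, ?_⟩
        simpa [mul_assoc] using hn.conj_mem _ a.2 t⁻¹
    refine ⟨R, {t | t ∈ R ∧ ∃ h : N, f (h * t) ≠ 0},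
      fun t => .ofCoeff (Finsupp.ofSupportFinite _ (hfin t)), hR, fun t ht => ht.1, ?_,
      fun t _ h => rfl, fun g hg => ?_⟩
    · refine BiOrder.PWOMod.wellOrdered (N := N) (partiallyWellOrderedOn_iff_exists_lt.2 ?_)
      intro t ht
      choose h hh using fun i => (ht i).2
      obtain ⟨i, j, hij, hle⟩ := hf.exists_lt hh
      refine ⟨i, j, hij, ?_⟩
      -- Equal terms have equal representatives by uniqueness of the decomposition; for distinct
      -- terms the factors in `N` can be stripped without changing the comparison.
      by_cases heq : (h i : G) * t i = h j * t j
      · refine Or.inl ?_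
        have := hR.1 (a₁ := (h i, ⟨t i, (ht i).1⟩)) (a₂ := (h j, ⟨t j, (ht j).1⟩)) heq
        exact congrArg (fun p => (p.2 : G)) this
      · have := hle.mul_mem_mul_mem hN heq (N.inv_mem (h i).2) (N.inv_mem (h j).2)
        simpa using this
    · by_contra hne
      obtain ⟨⟨h, t⟩, rfl⟩ := hR.2 g
      exact hg t ⟨t.2, ⟨h, h.2⟩, hne⟩ ⟨h, h.2⟩ rfl

end ControlledSeries

/-! ### Inverting series -/

namespace MalcevNeumann

open scoped Pointwise

variable {K : Type*} [DivisionRing K] {G : Type*} [Group G] {o : BiOrder G}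

theorem coeff_sub (x y : MalcevNeumann K o) (g : G) :
    (x - y).coeff g = x.coeff g - y.coeff g := by
  rw [sub_eq_add_neg, coeff_add, coeff_neg, sub_eq_add_neg]

theorem coeff_sum {ι : Type*} (s : Finset ι) (x : ι → MalcevNeumann K o) (g : G) :
    (∑ i ∈ s, x i).coeff g = ∑ i ∈ s, (x i).coeff g :=
  map_sum (⟨⟨fun x => x.coeff g, coeff_zero g⟩, fun x y => coeff_add x y g⟩ :
    MalcevNeumann K o →+ K) x s

theorem support_one_subset : Function.support (1 : MalcevNeumann K o).coeff ⊆ {1} :=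
  fun _ hg => by
    by_contra h
    exact hg (coeff_one_of_ne h)

theorem exists_list_of_coeff_pow_ne_zero (x : MalcevNeumann K o) (k : ℕ) :
    ∀ g, (x ^ k).coeff g ≠ 0 →
      ∃ l : List G, (∀ a ∈ l, a ∈ Function.support x.coeff) ∧ l.prod = g ∧ l.length = k := by
  induction k with
  | zero =>
    intro g hg
    rw [pow_zero] at hg
    have h1 : g = 1 := support_one_subset hg
    exact ⟨[], by simp, h1.symm, rfl⟩
  | succ k ih =>
    intro g hg
    rw [pow_succ'] at hg
    obtain ⟨a, ha, b, hb, rfl⟩ := support_mul_subset x (x ^ k) hg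
    obtain ⟨l, hl, rfl, hk⟩ := ih b hb
    exact ⟨a :: l, by simpa using ⟨ha, hl⟩, by simp, by simp [hk]⟩

/-- The geometric series: `1 - x` has a left inverse if the elements of the support of `x` are
positive modulo `N`. -/
theorem exists_mul_one_sub_eq_one {N : Subgroup G} [N.Normal] (hN : o.IsConvex N)
    (x : MalcevNeumann K o) (hx : o.PWOMod N (Function.support x.coeff))
    (hpos : ∀ g ∈ Function.support x.coeff, o.LEMod N 1 g ∧ g ≠ 1) :
    ∃ y : MalcevNeumann K o, o.PWOMod N (Function.support y.coeff) ∧ y * (1 - x) = 1 := by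
  have hcl : o.PWOMod N (Submonoid.closure (Function.support x.coeff) : Set G) := by
    let _ := BiOrder.modOrder hN
    have := BiOrder.modOrder_mulLeftMono hN
    have := BiOrder.modOrder_mulRightMono hN
    exact Set.IsPWO.submonoid_closure_of_mulMono (fun g hg => (hpos g hg).1) hx
  -- Each `g` occurs in finitely many powers, so the `∑ᶠ` below is a genuine sum and not the default
  -- value `0`.
  have hfin : ∀ g, {k | (x ^ k).coeff g ≠ 0}.Finite := fun g => by
    let _ := BiOrder.modOrder hN
    have := BiOrder.modOrder_mulLeftMono hN
    have := BiOrder.modOrder_mulRightMono hN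
    refine (Set.IsPWO.finite_setOf_length (s := Function.support x.coeff)
      (fun g hg => lt_of_le_of_ne (hpos g hg).1 (hpos g hg).2.symm) hx g).subset fun k hk => ?_
    exact exists_list_of_coeff_pow_ne_zero x k g hk
  have hcl_mem : ∀ k a, (x ^ k).coeff a ≠ 0 → a ∈ Submonoid.closure (Function.support x.coeff) :=
    fun k a hk => by
      obtain ⟨l, hl, rfl, -⟩ := exists_list_of_coeff_pow_ne_zero x k a hk
      exact Submonoid.list_prod_mem _ fun b hb => Submonoid.subset_closure (hl b hb)
  have hsupp : (Function.support fun g => ∑ᶠ k, (x ^ k).coeff g) ⊆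
      Submonoid.closure (Function.support x.coeff) := fun g hg => by
    obtain ⟨k, hk⟩ : ∃ k, (x ^ k).coeff g ≠ 0 := by
      by_contra! h
      exact hg (finsum_eq_zero_of_forall_eq_zero h)
    exact hcl_mem k g hk
  have hy := hcl.mono hsupp
  refine ⟨⟨_, hy.wellOrdered⟩, hy, ?_⟩
  ext g
  -- For a fixed `g`, only finitely many `a` and finitely many powers matter, so the series may be
  -- truncated at `M`; the telescoped remainder `x ^ M` does not contribute at `g`.
  have hbd : ∃ M, (x ^ M).coeff g = 0 ∧
      ∀ a, (1 - x).coeff (a⁻¹ * g) ≠ 0 → ∀ k, (x ^ k).coeff a ≠ 0 → k < M := by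
    obtain ⟨M, hM⟩ := (((hcl.wellOrdered.finite_setOf_mem (1 - x).wellOrdered_support g).biUnion
      fun a _ => hfin a).union (hfin g)).bddAbove
    refine ⟨M + 1, ?_, fun a ha k hk => Nat.lt_succ_of_le (hM (Or.inl ?_))⟩
    · by_contra h
      exact absurd (hM (Or.inr h)) (by omega)
    · exact Set.mem_biUnion (x := a) ⟨hcl_mem k a hk, ha⟩ hk
  obtain ⟨M, hMg, hM⟩ := hbd
  have hgeom : (∑ k ∈ Finset.range M, x ^ k) * (1 - x) = 1 - x ^ M := geom_sum_mul_neg x M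
  calc _ = ((∑ k ∈ Finset.range M, x ^ k) * (1 - x)).coeff g := by
        rw [coeff_mul, coeff_mul]
        refine finsum_congr fun a => ?_
        by_cases ha : (1 - x).coeff (a⁻¹ * g) = 0
        · rw [ha, mul_zero, mul_zero]
        · have hsum : ∑ᶠ k, (x ^ k).coeff a = ∑ k ∈ Finset.range M, (x ^ k).coeff a :=
            finsum_eq_sum_of_support_subset _ fun k hk => by simpa using hM a ha k hk
          rw [coeff_sum, ← hsum]
    _ = _ := by rw [hgeom, coeff_sub, hMg, sub_zero]

theorem pwoMod_support_mul {N : Subgroup G} [N.Normal] (hN : o.IsConvex N)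
    {x y : MalcevNeumann K o} (hx : o.PWOMod N (Function.support x.coeff))
    (hy : o.PWOMod N (Function.support y.coeff)) :
    o.PWOMod N (Function.support (x * y).coeff) :=
  (hx.mul hN hy).mono (support_mul_subset x y)

theorem pwoMod_support_add {N : Subgroup G} {x y : MalcevNeumann K o}
    (hx : o.PWOMod N (Function.support x.coeff)) (hy : o.PWOMod N (Function.support y.coeff)) :
    o.PWOMod N (Function.support (x + y).coeff) :=
  (PartiallyWellOrderedOn.union hx hy).mono (Function.support_add _ _)

theorem pwoMod_support_neg {N : Subgroup G} {x : MalcevNeumann K o}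
    (hx : o.PWOMod N (Function.support x.coeff)) : o.PWOMod N (Function.support (-x).coeff) :=
  hx.mono fun _ hg => neg_ne_zero.1 hg

theorem pwoMod_support_one {N : Subgroup G} (hN : o.IsConvex N) :
    o.PWOMod N (Function.support (1 : MalcevNeumann K o).coeff) :=
  BiOrder.pwoMod_of_finite hN ((Set.finite_singleton 1).subset support_one_subset)

open Classical in
/-- The series `c * g` with a single term. -/
noncomputable def single (o : BiOrder G) (g : G) (c : K) : MalcevNeumann K o where
  coeff := Pi.single g c
  wellOrdered_support :=
    o.wellOrdered_of_finite ((Set.finite_singleton g).subset Pi.support_single_subset)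

theorem support_single_subset (g : G) (c : K) : Function.support (single o g c).coeff ⊆ {g} :=
  fun h hh => by
    classical
    by_contra hne
    exact hh (Pi.single_eq_of_ne (M := fun _ : G => K) hne c)

theorem coeff_single_mul (g : G) (c : K) (x : MalcevNeumann K o) (h : G) :
    (single o g c * x).coeff h = c * x.coeff (g⁻¹ * h) := by
  rw [coeff_mul, finsum_eq_single _ g fun a ha => by
    rw [Function.notMem_support.1 fun h => ha (support_single_subset g c h), zero_mul]]
  simp [single]

/-- A series whose leading coset modulo `N` contains only one term has a left inverse. -/
theorem exists_mul_eq_one_of_isLeast {N : Subgroup G} [N.Normal] (hN : o.IsConvex N)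
    {x : MalcevNeumann K o} (hx : o.PWOMod N (Function.support x.coeff)) {g : G}
    (hg : x.coeff g ≠ 0) (hmin : ∀ h ∈ Function.support x.coeff, o.LEMod N g h) :
    ∃ y : MalcevNeumann K o, o.PWOMod N (Function.support y.coeff) ∧ y * x = 1 := by
  -- Multiplying by `u` moves the leading term to `1` with coefficient `1`. It cancels in `1 - u *
  -- x`, whose support then lies strictly above `1` modulo `N`.
  set u : MalcevNeumann K o := single o g⁻¹ (x.coeff g)⁻¹ with hu
  have hu' : o.PWOMod N (Function.support u.coeff) :=
    BiOrder.pwoMod_of_finite hN ((Set.finite_singleton _).subset (support_single_subset _ _))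
  have hux := pwoMod_support_mul hN hu' hx
  obtain ⟨y, hy, hyx⟩ := exists_mul_one_sub_eq_one hN (1 - u * x)
    (by
      rw [sub_eq_add_neg]
      exact pwoMod_support_add (pwoMod_support_one hN) (pwoMod_support_neg hux))
    (by
      intro h hh
      have hh1 : h ≠ 1 := by
        rintro rfl
        refine hh ?_
        rw [coeff_sub, coeff_one_one, hu, coeff_single_mul, inv_inv, mul_one,
          inv_mul_cancel₀ hg, sub_self]
      refine ⟨?_, hh1⟩
      rw [Function.mem_support, coeff_sub, coeff_one_of_ne hh1, zero_sub, neg_ne_zero, hu,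
        coeff_single_mul, inv_inv] at hh
      simpa using (hmin _ (right_ne_zero_of_mul hh)).mul_left g⁻¹)
  rw [sub_sub_cancel, ← mul_assoc] at hyx
  exact ⟨y * u, pwoMod_support_mul hN hy hu', hyx⟩

end MalcevNeumann

/-! ### The division ring of series controlled modulo some isolator -/

section EizenbudLichtman

variable {G : Type*} [Group G]

/-- The ring of all series whose support is partially well-ordered modulo some isolator. -/
noncomputable def pwoModIsolatorSubring (K : Type*) [DivisionRing K]
    (hG : IsResiduallyTorsionFreeNilpotent G) (P : ∀ n, BiOrder (IsolatorQuotient G n)) :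
    Subring (MalcevNeumann K (isolatorOrder hG P)) where
  carrier := {x | ∃ n, (isolatorOrder hG P).PWOMod (isolator G n) (Function.support x.coeff)}
  zero_mem' := ⟨0, BiOrder.pwoMod_of_finite (isConvex_isolator hG 0)
    (Set.finite_empty.subset fun _ hg => hg rfl)⟩
  one_mem' := ⟨0, MalcevNeumann.pwoMod_support_one (isConvex_isolator hG 0)⟩
  neg_mem' := fun ⟨n, hn⟩ => ⟨n, MalcevNeumann.pwoMod_support_neg hn⟩
  add_mem' := fun ⟨n, hn⟩ ⟨m, hm⟩ => ⟨max n m, MalcevNeumann.pwoMod_support_add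
    (hn.of_le (isolator_antitone (le_max_left n m)))
    (hm.of_le (isolator_antitone (le_max_right n m)))⟩
  mul_mem' := fun ⟨n, hn⟩ ⟨m, hm⟩ => ⟨max n m, MalcevNeumann.pwoMod_support_mul
    (isConvex_isolator hG _)
    (hn.of_le (isolator_antitone (le_max_left n m)))
    (hm.of_le (isolator_antitone (le_max_right n m)))⟩

variable {K : Type*} [DivisionRing K] {hG : IsResiduallyTorsionFreeNilpotent G}
  {P : ∀ n, BiOrder (IsolatorQuotient G n)}

/-- Each nontrivial element leaves the decreasing chain of isolators at some level, and finitely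
many such levels have a common bound. -/
theorem IsResiduallyTorsionFreeNilpotent.exists_forall_notMem_isolator
    (hG : IsResiduallyTorsionFreeNilpotent G) {s : Set G} (hs : s.Finite) (n : ℕ) :
    ∃ m, n ≤ m ∧ ∀ x ∈ s, x ≠ 1 → x ∉ isolator G m := by
  have h : ∀ x : G, ∃ m, x ≠ 1 → x ∉ isolator G m := fun x => by
    by_cases hx : x = 1
    · exact ⟨0, fun h => absurd hx h⟩
    · exact (hG.exists_notMem_isolator hx).imp fun _ h _ => h
  choose f hf using h
  obtain ⟨M, hM⟩ := (hs.image f).bddAbove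
  refine ⟨max n M, le_max_left _ _, fun x hx hx1 hmem => hf x hx1 ?_⟩
  exact isolator_antitone ((hM ⟨x, hx, rfl⟩).trans (le_max_right _ _)) hmem

theorem exists_mul_eq_one_of_mem_pwoModIsolatorSubring
    {x : MalcevNeumann K (isolatorOrder hG P)} (hx : x ∈ pwoModIsolatorSubring K hG P)
    (hx0 : x ≠ 0) : ∃ y ∈ pwoModIsolatorSubring K hG P, y * x = 1 := by
  obtain ⟨n, hn⟩ := hx
  have hne : (Function.support x.coeff).Nonempty := by
    by_contra h
    refine hx0 (MalcevNeumann.ext ?_)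
    exact Function.support_eq_empty_iff.1 (Set.not_nonempty_iff_eq_empty.1 h)
  obtain ⟨g, hg, hmin⟩ : ∃ g ∈ Function.support x.coeff,
      ∀ h ∈ Function.support x.coeff, (isolatorOrder hG P).le g h := by
    let _ := (isolatorOrder hG P).toLinearOrder
    have hwf : (Function.support x.coeff).IsWF := x.wellOrdered_support
    exact ⟨hwf.min hne, hwf.min_mem hne, fun h hh => hwf.min_le hne hh⟩
  -- The change of level: modulo the `m`-th isolator, `g` is alone in its coset among the elements
  -- of the support.
  obtain ⟨m, hnm, hm⟩ := hG.exists_forall_notMem_isolator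
    ((hn.finite_coset g).image fun h => g⁻¹ * h) n
  obtain ⟨y, hy, hyx⟩ := MalcevNeumann.exists_mul_eq_one_of_isLeast (isConvex_isolator hG m)
    (hn.of_le (isolator_antitone hnm)) hg fun h hh => by
      by_cases hgh : g = h
      · exact Or.inl hgh
      refine Or.inr ⟨(hmin h hh).resolve_left hgh, fun hmem => ?_⟩
      exact hm _ ⟨h, ⟨hh, isolator_antitone hnm hmem⟩, rfl⟩
        (fun h1 => hgh (inv_mul_eq_one.1 h1)) hmem
  exact ⟨y, ⟨m, hy⟩, hyx⟩

theorem image_coeff_pwoModIsolatorSubring :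
    MalcevNeumann.coeff '' (pwoModIsolatorSubring ℚ hG P : Set (MalcevNeumann ℚ (isolatorOrder hG P))) =
      eizenbudLichtman (isolatorOrder hG P) := by
  ext f
  simp only [eizenbudLichtman, Set.mem_iUnion, mem_controlledSeries_iff (isConvex_isolator hG _)]
  constructor
  · rintro ⟨x, hx, rfl⟩
    exact hx
  · rintro ⟨n, hn⟩
    exact ⟨⟨f, hn.wellOrdered⟩, ⟨n, hn⟩, rfl⟩

end EizenbudLichtman

theorem mainTheorem8 {G : Type*} [Group G] [Group.FG G]
    (hG : IsResiduallyTorsionFreeNilpotent G) (P : ∀ n, BiOrder (IsolatorQuotient G n)) :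
    ∃ D : Subring (MalcevNeumann ℚ (isolatorOrder hG P)),
      MalcevNeumann.coeff '' (D : Set (MalcevNeumann ℚ (isolatorOrder hG P))) =
        eizenbudLichtman (isolatorOrder hG P) ∧
      Nontrivial D ∧
      ∀ x ∈ D, x ≠ 0 → ∃ y ∈ D, x * y = 1 ∧ y * x = 1 := by
  have hnt : (1 : MalcevNeumann ℚ (isolatorOrder hG P)) ≠ 0 := fun h => by
    have := congrArg (fun x => MalcevNeumann.coeff x 1) h
    simp [MalcevNeumann.coeff_one_one, MalcevNeumann.coeff_zero] at this
  refine ⟨pwoModIsolatorSubring ℚ hG P, image_coeff_pwoModIsolatorSubring,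
    ⟨⟨1, 0, fun h => hnt (congrArg Subtype.val h)⟩⟩, fun x hx hx0 => ?_⟩
  obtain ⟨y, hy, hyx⟩ := exists_mul_eq_one_of_mem_pwoModIsolatorSubring hx hx0
  have hy0 : y ≠ 0 := by
    rintro rfl
    rw [zero_mul] at hyx
    exact hnt hyx.symm
  -- Left inverses suffice: `y` has a left inverse `z` and the right inverse `x`, so `z = x`.
  obtain ⟨z, -, hzy⟩ := exists_mul_eq_one_of_mem_pwoModIsolatorSubring hy hy0
  have hzx : z = x := left_inv_eq_right_inv hzy hyx
  exact ⟨y, hy, hzx ▸ hzy, hyx⟩
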